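/- Let $k$ be an algebraically closed field of characteristic $p>0$ and let $G=\mathbb{G}_a$ be the additive group of $k$. A $G$-variety is an irreducible algebraic variety over $k$ with a morphic action of $G$; it is homogeneous if $G$ acts transitively on it. For $G$-varieties $X_1,\dots,X_m$ let $G$ act diagonally on $X=\prod_{i=1}^m X_i$; for $I\subseteq\{1,\dots,m\}$ put $X_I=\prod_{i\in I}X_i$ and regard $k(X_I)$, and its subfield $k(X_I)^G$ of rational invariants, as subfields of $k(X)$ through the projection $X\to X_I$. A set $S\subseteq k(X)^G$ separates orbits in general position in $X$ if there is a dense open subset $U\subseteq X$ such that for all $x,y\in U$ with $G\cdot x\neq G\cdot y$ there is an $f\in S$, defined both at $x$ and at $y$, with $f(x)\neq f(y)$. Let $\rho(G,X)$ be the minimal natural number $r$ such that $\bigcup_{|I|\le r}k(X_I)^G$ separates orbits in general position in $X$, and let $\rho(G)$ be the supremum of $\rho(G,X)$ over all finite products $X$ of $G$-varieties. Then the following hold. 1. $\rho(\mathbb{G}_a)=\infty$. 2. For every integer $d\ge 1$ there are homogeneous $\mathbb{G}_a$-varieties $X_1,\dots,X_{d+1}$ such that every set $S\subseteq k(X)^{\mathbb{G}_a}$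 that separates orbits in general position in $X=\prod_{i=1}^{d+1}X_i$ contains an element depending on all $d+1$ factors, that is, an element lying in $k(X_I)$ for no proper subset $I\subsetneq\{1,\dots,d+1\}$. 3. For every natural number $r$ there is a finite product $X$ of $\mathbb{G}_a$-varieties such that the field $k(X)^{\mathbb{G}_a}$ is not generated by its subfields $k(X_I)^{\mathbb{G}_a}$ with $|I|\le r$. -/

import Mathlib

open CategoryTheory Limits AlgebraicGeometry MonoidalCategory CartesianMonoidalCategory

universe u

noncomputable section

namespace RationalInvariants

/-! ### The additive group over a field -/

section AdditiveGroup

variable (k : Type u) [Field k]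

/-- The affine line over `Spec k`, as a scheme over `Spec k`; the group law is defined below. -/
abbrev Ga : Over (Spec (.of k)) := Over.mk (𝔸(PUnit.{u + 1}; Spec (.of k)) ↘ Spec (.of k))

namespace Ga

variable {k}

/-- The global function on `T` given by a morphism from `T` to the affine line. -/
def coord {T : Over (Spec (.of k))} (f : T ⟶ Ga k) : Γ(T.left, ⊤) :=
  f.left.appTop (AffineSpace.coord (Spec (.of k)) PUnit.unit)

/-- The morphism from `T` to the affine line given by a global function on `T`. -/
def ofSection {T : Over (Spec (.of k))} (s : Γ(T.left, ⊤)) : T ⟶ Ga k :=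
  Over.homMk (AffineSpace.homOfVector T.hom fun _ => s) (AffineSpace.homOfVector_over _ _)

theorem coord_ofSection {T : Over (Spec (.of k))} (s : Γ(T.left, ⊤)) :
    coord (ofSection s) = s := by
  simp [coord, ofSection, AffineSpace.homOfVector_appTop_coord, -TopologicalSpace.Opens.map_top]

theorem coord_comp {T T' : Over (Spec (.of k))} (h : T ⟶ T') (f : T' ⟶ Ga k) :
    coord (h ≫ f) = h.left.appTop (coord f) := by
  rfl

theorem hom_ext {T : Over (Spec (.of k))} {f g : T ⟶ Ga k} (h : coord f = coord g) : f = g := by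
  apply Over.OverMorphism.ext
  apply AffineSpace.hom_ext
  · exact (Over.w f).trans (Over.w g).symm
  · intro i
    exact h

theorem comp_ofSection {T T' : Over (Spec (.of k))} (h : T ⟶ T') (s : Γ(T'.left, ⊤)) :
    h ≫ ofSection s = ofSection (h.left.appTop s) := 
  hom_ext (by rw [coord_comp, coord_ofSection, coord_ofSection])

variable (k) in
/-- Addition on the affine line: the sum of the two coordinate functions. -/
def add : Ga k ⊗ Ga k ⟶ Ga k :=
  ofSection (coord (fst (Ga k) (Ga k)) + coord (snd (Ga k) (Ga k)))

theorem coord_lift_add {T : Over (Spec (.of k))} (f g : T ⟶ Ga k) :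
    coord (lift f g ≫ add k) = coord f + coord g := by
  rw [add, coord_comp, coord_ofSection, map_add, ← coord_comp, ← coord_comp, lift_fst, lift_snd]

theorem coord_comp_add {T : Over (Spec (.of k))} (f : T ⟶ Ga k ⊗ Ga k) :
    coord (f ≫ add k) = coord (f ≫ fst _ _) + coord (f ≫ snd _ _) := by
  rw [add, coord_comp, coord_ofSection, map_add, ← coord_comp, ← coord_comp]

/-- The additive group: the group law is addition (in the multiplicative notation that Mathlib
uses for group objects), the unit is the point `0` and the inverse is negation. -/
instance : GrpObj (Ga k) where
  one := ofSection 0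
  mul := add k
  inv := ofSection (-coord (𝟙 (Ga k)))
  one_mul := hom_ext (by
    rw [coord_comp_add, whiskerRight_fst, whiskerRight_snd, comp_ofSection, coord_ofSection,
      map_zero, zero_add, leftUnitor_hom])
  mul_one := hom_ext (by
    rw [coord_comp_add, whiskerLeft_fst, whiskerLeft_snd, comp_ofSection, coord_ofSection,
      map_zero, add_zero, rightUnitor_hom])
  mul_assoc := hom_ext (by
    rw [coord_comp_add, whiskerRight_fst, whiskerRight_snd, coord_comp_add, ← Category.assoc,
      coord_comp_add, Category.assoc, Category.assoc, whiskerLeft_fst, whiskerLeft_snd,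
      associator_hom_fst, ← Category.assoc, coord_comp_add, Category.assoc, Category.assoc,
      associator_hom_snd_fst, associator_hom_snd_snd, add_assoc])
  left_inv := hom_ext (by
    rw [coord_lift_add, coord_ofSection, comp_ofSection, coord_ofSection, map_zero]
    simp)
  right_inv := hom_ext (by
    rw [coord_lift_add, coord_ofSection, comp_ofSection, coord_ofSection, map_zero]
    simp)

end Ga

end AdditiveGroup

/-! ### Varieties -/

section Varieties

variable {k : Type u} [Field k]

/-- A variety over `k`: a geometrically integral, separated scheme of finite type over `k`.
Below `k` is algebraically closed, and then geometrically integral means the same as integral,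
that is, irreducible and reduced. -/
structure IsVariety (X : Over (Spec (.of k))) : Prop where
  geometricallyIntegral : GeometricallyIntegral X.hom
  isSeparated : IsSeparated X.hom
  locallyOfFiniteType : LocallyOfFiniteType X.hom
  quasiCompact : QuasiCompact X.hom

namespace IsVariety

instance : ObjectProperty.IsClosedUnderIsomorphisms AlgebraicGeometry.IsIntegral.{u} where
  of_iso {X Y} e _ :=
    have : Nonempty Y := ⟨e.hom (genericPoint X)⟩
    isIntegral_of_isOpenImmersion e.inv

theorem geometricallyIntegral_comp {X Y Z : Scheme.{u}} (f : X ⟶ Y) (g : Y ⟶ Z)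
    [GeometricallyIntegral f] [Flat f] [UniversallyOpen f]
    [GeometricallyIntegral g] [LocallyOfFiniteType g] : GeometricallyIntegral (f ≫ g) := by
  rw [geometricallyIntegral_iff, geometrically_iff_of_isClosedUnderIsomorphisms]
  intro K _ y
  have : IsIntegral (pullback g y) :=
    GeometricallyIntegral.geometrically_isIntegral _ _ _ (.of_hasPullback _ _)
  have : IsLocallyNoetherian (pullback g y) :=
    LocallyOfFiniteType.isLocallyNoetherian (pullback.snd g y)
  exact ObjectProperty.prop_of_iso _ (pullbackRightPullbackFstIso g y f)
    (inferInstanceAs (IsIntegral (pullback f (pullback.fst g y))))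

theorem of_iso {X Y : Over (Spec (.of k))} (e : X ≅ Y) (h : IsVariety X) : IsVariety Y := by
  obtain ⟨h1, h2, h3, h4⟩ := h
  let i : X.left ≅ Y.left := (Over.forget _).mapIso e
  have hY : Y.hom = i.inv ≫ X.hom := (Over.w e.inv).symm
  refine ⟨?_, ?_, ?_, ?_⟩
  · rw [GeometricallyIntegral.eq_geometrically] at h1 ⊢
    rw [hY]
    exact (MorphismProperty.cancel_left_of_respectsIso (geometrically IsIntegral) _ _).2 h1
  all_goals
    rw [hY]
    infer_instance

theorem tensorUnit : IsVariety (𝟙_ (Over (Spec (.of k)))) := by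
  refine ⟨?_, ?_, ?_, ?_⟩
  · rw [geometricallyIntegral_iff, geometrically_iff_of_isClosedUnderIsomorphisms]
    intro K _ y
    have : IsIntegral (pullback (𝟙 (Spec (.of k))) y) := 
      isIntegral_of_isOpenImmersion (pullback.snd _ _)
    exact this
  · exact inferInstanceAs (IsSeparated (𝟙 (Spec (.of k))))
  · exact inferInstanceAs (LocallyOfFiniteType (𝟙 (Spec (.of k))))
  · exact inferInstanceAs (QuasiCompact (𝟙 (Spec (.of k))))

theorem tensor {X Y : Over (Spec (.of k))} (hX : IsVariety X) (hY : IsVariety Y) :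
    IsVariety (X ⊗ Y) := by
  obtain ⟨h1, h2, h3, h4⟩ := hX
  obtain ⟨g1, g2, g3, g4⟩ := hY
  refine ⟨geometricallyIntegral_comp (pullback.fst X.hom Y.hom) X.hom, ?_, ?_, ?_⟩ <;>
  · rw [Over.tensorObj_hom]
    infer_instance

theorem pi {J : Type} [Finite J] (X : J → Over (Spec (.of k))) (h : ∀ i, IsVariety (X i)) :
    IsVariety (∏ᶜ X) := by
  revert X
  refine Finite.induction_empty_option (P := fun J => ∀ (_ : Finite J) (X : J → Over (Spec (.of k))),
    (∀ i, IsVariety (X i)) → IsVariety (∏ᶜ X)) ?_ ?_ ?_ J inferInstance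
  · intro A B e ih _ X h
    have : Finite A := Finite.of_equiv B e.symm
    exact of_iso (Pi.reindex e X) (ih this (X ∘ e) fun i => h (e i))
  · intro _ X h
    exact of_iso
      { hom := Pi.lift fun i => i.elim
        inv := toUnit _
        hom_inv_id := toUnit_unique _ _
        inv_hom_id := Pi.hom_ext _ _ fun i => i.elim } tensorUnit
  · intro A _ ih _ X h
    let f : ∀ i, X none ⊗ ∏ᶜ (fun i => X (some i)) ⟶ X i := fun i =>
      match i with
      | none => fst _ _
      | some i => snd _ _ ≫ Pi.π (fun i => X (some i)) i
    refine of_iso (X := X none ⊗ ∏ᶜ fun i => X (some i)) ?_ (tensor (h none) (ih (Finite.of_fintype A) (fun i => X (some i)) fun i => h (some i)))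
    exact
      { hom := Pi.lift f
        inv := lift (Pi.π X none) (Pi.lift fun i => Pi.π X (some i))
        hom_inv_id := by
          apply CartesianMonoidalCategory.hom_ext
          · simp [f]
          · apply Pi.hom_ext
            intro i
            simp [f]
        inv_hom_id := by
          apply Pi.hom_ext
          rintro (_ | i) <;> simp [f] }

theorem isIntegral {X : Over (Spec (.of k))} (h : IsVariety X) : IsIntegral X.left :=
  have := h.geometricallyIntegral
  GeometricallyIntegral.isIntegral_of_subsingleton X.hom

theorem exists_point [IsAlgClosed k] {X : Over (Spec (.of k))} (h : IsVariety X) :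
    Nonempty (𝟙_ (Over (Spec (.of k))) ⟶ X) := by
  have := h.isIntegral
  have := h.locallyOfFiniteType
  have := h.quasiCompact
  have : JacobsonSpace X.left := LocallyOfFiniteType.jacobsonSpace (Y := Spec _) X.hom
  obtain ⟨x, -, hx⟩ := nonempty_inter_closedPoints (X := X.left) (Z := Set.univ)
    Set.univ_nonempty isOpen_univ.isLocallyClosed
  exact ⟨Over.homMk (pointOfClosedPoint X.hom x hx) (pointOfClosedPoint_comp _ _ _)⟩

end IsVariety

/-- The `k`-rational points of `X`; for `k` algebraically closed these are the points of the
variety `X` in the classical sense. -/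
abbrev Point (X : Over (Spec (.of k))) : Type u := 𝟙_ (Over (Spec (.of k))) ⟶ X

/-- The point of the underlying space of `X` given by a `k`-rational point. -/
def Point.pt {X : Over (Spec (.of k))} (x : Point X) : X.left :=
  x.left (IsLocalRing.closedPoint k)

/-- Evaluation at the `k`-rational point `x` of the functions that are regular near `x`. -/
def Point.eval {X : Over (Spec (.of k))} (x : Point X) : X.left.presheaf.stalk x.pt →+* k :=
  (Scheme.stalkClosedPointTo (R := .of k) x.left).hom

theorem map_genericPoint {X Y : Scheme.{u}} [IrreducibleSpace X] [IrreducibleSpace Y] (f : X ⟶ Y)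
    [IsDominant f] : f (genericPoint X) = genericPoint Y := by
  have h := (genericPoint_spec X).image f.continuous
  rw [Set.image_univ, f.denseRange.closure_range] at h
  exact h.eq (genericPoint_spec Y)

/-- The embedding `k(Y) → k(X)` of function fields (pull-back of rational functions) given by a
dominant morphism `X ⟶ Y`. -/
def functionFieldMap {X Y : Scheme.{u}} [IrreducibleSpace X] [IrreducibleSpace Y] (f : X ⟶ Y)
    [IsDominant f] : Y.functionField →+* X.functionField :=
  (Y.presheaf.stalkSpecializes (specializes_of_eq (map_genericPoint f)) ≫
    f.stalkMap (genericPoint X)).hom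

end Varieties

/-! ### Varieties with a group action -/

section Actions

variable {k : Type u} [Field k]

/-- An (irreducible) variety with a morphic action of the algebraic group `G`. -/
structure GVariety (G : Over (Spec (.of k))) [GrpObj G] where
  /-- the underlying scheme over `k` -/
  space : Over (Spec (.of k))
  isVariety : IsVariety space
  /-- the action -/
  modObj : ModObj G space

attribute [instance] GVariety.modObj

variable {G : Over (Spec (.of k))} [GrpObj G]

namespace GVariety

instance (X : GVariety G) : IsIntegral X.space.left := X.isVariety.isIntegral

/-- The action morphism `G × X ⟶ X`. -/
abbrev act (X : GVariety G) : G ⊗ X.space ⟶ X.space := ModObj.smul (M := G) (X := X.space)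

theorem one_act (X : GVariety G) : MonObj.one ▷ X.space ≫ X.act = (λ_ X.space).hom :=
  ModObj.one_smul (M := G) X.space

theorem mul_act (X : GVariety G) :
    MonObj.mul ▷ X.space ≫ X.act = (α_ G G X.space).hom ≫ G ◁ X.act ≫ X.act :=
  ModObj.mul_smul (M := G) X.space

/-- The product of finitely many `G`-varieties, with the diagonal action. -/
def prod {J : Type} [Finite J] (X : J → GVariety G) : GVariety G where
  space := ∏ᶜ fun i => (X i).space
  isVariety := .pi _ fun i => (X i).isVariety
  modObj :=
    { smul := Pi.lift fun i => (G ◁ Pi.π (fun i => (X i).space) i) ≫ (X i).act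
      one_smul := by
        apply Pi.hom_ext
        intro i
        change (MonObj.one ▷ (∏ᶜ fun i => (X i).space) ≫
          Pi.lift fun i => (G ◁ Pi.π (fun i => (X i).space) i) ≫ (X i).act) ≫ _ =
            (λ_ (∏ᶜ fun i => (X i).space)).hom ≫ _
        rw [Category.assoc, Pi.lift_π, ← whisker_exchange_assoc, one_act, leftUnitor_naturality]
      mul_smul := by
        apply Pi.hom_ext
        intro i
        change (MonObj.mul ▷ (∏ᶜ fun i => (X i).space) ≫
          Pi.lift fun i => (G ◁ Pi.π (fun i => (X i).space) i) ≫ (X i).act) ≫ _ =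
            ((α_ G G (∏ᶜ fun i => (X i).space)).hom ≫
              G ◁ (Pi.lift fun i => (G ◁ Pi.π (fun i => (X i).space) i) ≫ (X i).act) ≫
                Pi.lift fun i => (G ◁ Pi.π (fun i => (X i).space) i) ≫ (X i).act) ≫ _
        simp only [Category.assoc, Pi.lift_π]
        rw [← whisker_exchange_assoc, mul_act, ← MonoidalCategory.whiskerLeft_comp_assoc,
          Pi.lift_π, MonoidalCategory.whiskerLeft_comp_assoc]
        simp }

theorem prod_act_π {J : Type} [Finite J] (X : J → GVariety G) (i : J) :
    (prod X).act ≫ Pi.π (fun i => (X i).space) i = (G ◁ Pi.π (fun i => (X i).space) i) ≫ (X i).act :=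
  Pi.lift_π _ _


/-- The action of a point of `G` on a point of `X`. -/
def smul (X : GVariety G) (g : Point G) (x : Point X.space) : Point X.space := lift g x ≫ X.act

/-- The points `x` and `y` lie in the same `G`-orbit. -/
def SameOrbit (X : GVariety G) (x y : Point X.space) : Prop := ∃ g : Point G, X.smul g x = y

/-- `X` is a homogeneous space: `G` acts transitively on (the points of) `X`. -/
def IsHomogeneous (X : GVariety G) : Prop := ∀ x y : Point X.space, X.SameOrbit x y

/-- The morphism `x ↦ g • x` from `X` to `X`, for a point `g` of `G`. -/
def translate (X : GVariety G) (g : Point G) : X.space ⟶ X.space :=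
  lift (toUnit X.space ≫ g) (𝟙 X.space) ≫ X.act

theorem comp_translate (X : GVariety G) (g : Point G) (x : Point X.space) :
    x ≫ X.translate g = X.smul g x := by
  rw [translate, smul, comp_lift_assoc, Category.comp_id, ← Category.assoc,
    toUnit_unique (x ≫ toUnit X.space) (𝟙 _), Category.id_comp]

theorem translate_comp (X : GVariety G) (g h : Point G) :
    X.translate h ≫ X.translate g = X.translate (lift g h ≫ MonObj.mul) := by
  have e : lift (toUnit X.space ≫ lift g h ≫ MonObj.mul) (𝟙 X.space) =
      lift (lift (toUnit X.space ≫ g) (toUnit X.space ≫ h)) (𝟙 X.space) ≫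
        MonObj.mul ▷ X.space := by
    rw [lift_whiskerRight, ← comp_lift, Category.assoc]
  rw [translate, translate, translate, e, Category.assoc, Category.assoc, mul_act, lift_lift_associator_hom_assoc,
    lift_whiskerLeft_assoc, comp_lift_assoc, Category.comp_id, ← Category.assoc X.act,
    toUnit_unique (X.act ≫ toUnit X.space) (toUnit _), comp_lift_assoc, ← Category.assoc _ _ g,
    toUnit_unique (_ ≫ toUnit _) (toUnit X.space)]

theorem translate_one (X : GVariety G) : X.translate MonObj.one = 𝟙 X.space := by
  rw [translate, ← lift_whiskerRight_assoc, one_act, lift_leftUnitor_hom]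

instance (X : GVariety G) (g : Point G) : IsIso (X.translate g) := by
  refine ⟨X.translate (g ≫ GrpObj.inv), ?_, ?_⟩
  · rw [translate_comp, ← X.translate_one]
    simp
  · rw [translate_comp, ← X.translate_one]
    simp

instance (X : GVariety G) (g : Point G) : IsDominant (X.translate g).left := by
  have : IsIso (X.translate g).left := inferInstanceAs (IsIso ((Over.forget _).map (X.translate g)))
  infer_instance

/-- The field `k(X)` of rational functions on `X`. -/
abbrev K (X : GVariety G) : Type u := X.space.left.functionField

/-- The field `k(X)^G` of rational invariants: the rational functions fixed by the pull-backs
along the translations by all points of `G`. -/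
def invariants (X : GVariety G) : Subfield X.K :=
  ⨅ g : Point G, (functionFieldMap (X.translate g).left).eqLocusField (RingHom.id X.K)

/-- The rational function `f` is defined at the point `x` and has the value `c` there. -/
def HasValueAt (X : GVariety G) (f : X.K) (x : Point X.space) (c : k) : Prop :=
  ∃ s : X.space.left.presheaf.stalk x.pt, algebraMap _ X.K s = f ∧ x.eval s = c

/-- `S` separates orbits in `U`: points `x`, `y` of `U` in different orbits are told apart by
an element of `S` that is defined both at `x` and at `y`. -/
def SeparatesOrbitsIn (X : GVariety G) (S : Set X.K) (U : X.space.left.Opens) : Prop :=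
  ∀ x y : Point X.space, x.pt ∈ U → y.pt ∈ U → ¬ X.SameOrbit x y →
    ∃ f ∈ S, ∃ a b : k, X.HasValueAt f x a ∧ X.HasValueAt f y b ∧ a ≠ b

/-- `S` separates orbits in general position: it separates orbits in a dense open subset. -/
def SeparatesOrbitsInGeneralPosition (X : GVariety G) (S : Set X.K) : Prop :=
  ∃ U : X.space.left.Opens, Dense (U : Set X.space.left) ∧ X.SeparatesOrbitsIn S U

section Product

variable {J : Type} [Finite J] (X : J → GVariety G) (I : Finset J)

/-- The partial product `X_I`, the product of the `X i` with `i ∈ I`. -/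
abbrev partialProd : GVariety G := prod fun i : I => X i

/-- The projection from the product of all the `X i` to the partial product `X_I`. -/
def proj : (prod X).space ⟶ (partialProd X I).space :=
  Pi.lift fun i : I => Pi.π (fun j => (X j).space) i

variable [IsAlgClosed k]

instance : IsDominant (proj X I).left := by
  classical
  have c : ∀ j, Point (X j).space := fun j => (X j).isVariety.exists_point.some
  let s : (partialProd X I).space ⟶ (prod X).space := Pi.lift fun j =>
    if h : j ∈ I then Pi.π (fun i : I => (X i).space) ⟨j, h⟩ else toUnit _ ≫ c j
  have hs : s ≫ proj X I = 𝟙 _ := by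
    apply Pi.hom_ext
    intro i
    change (s ≫ proj X I) ≫ Pi.π (fun i : I => (X i).space) i =
      𝟙 (∏ᶜ fun i : I => (X i).space) ≫ Pi.π (fun i : I => (X i).space) i
    have h1 : proj X I ≫ Pi.π (fun i : I => (X i).space) i = Pi.π (fun j => (X j).space) i :=
      Pi.lift_π _ _
    have h2 : s ≫ Pi.π (fun j => (X j).space) i = Pi.π (fun i : I => (X i).space) i :=
      (Pi.lift_π _ _).trans (dif_pos i.2)
    rw [Category.id_comp]
    exact (Category.assoc _ _ _).trans ((congrArg (s ≫ ·) h1).trans h2)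
  have hs' : s.left ≫ (proj X I).left = 𝟙 _ := by
    rw [← Over.comp_left, hs, Over.id_left]
  refine ⟨Function.Surjective.denseRange fun y => ⟨s.left y, ?_⟩⟩
  rw [← Scheme.Hom.comp_apply, hs']
  rfl

/-- The field `k(X_I)`, as a subfield of the function field of the product. -/
def partialField : Subfield (prod X).K := (functionFieldMap (proj X I).left).fieldRange

/-- The field `k(X_I)^G`, as a subfield of the function field of the product. -/
def partialInvariants : Subfield (prod X).K :=
  (partialProd X I).invariants.map (functionFieldMap (proj X I).left)

/-- `ρ(G, X)`: the minimal natural number `r` such that the union of the subfields `k(X_I)^G`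
with `|I| ≤ r` separates orbits in general position in the product `X`. -/
def rhoProd : ℕ∞ :=
  sInf {n : ℕ∞ | ∃ r : ℕ, n = r ∧ (prod X).SeparatesOrbitsInGeneralPosition
    (⋃ (I : Finset J) (_ : I.card ≤ r), (partialInvariants X I : Set (prod X).K))}

end Product

end GVariety

/-- `ρ(G)`: the supremum of `ρ(G, X)` over all finite products `X` of `G`-varieties. -/
def rho [IsAlgClosed k] (G : Over (Spec (.of k))) [GrpObj G] : ℕ∞ :=
  ⨆ (m : ℕ) (X : Fin m → GVariety G), GVariety.rhoProd X

end Actions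

end RationalInvariants

end

open RationalInvariants

/-! In characteristic `p` an additive polynomial `P = ∑ aᵢ t ^ (p ^ i)` lets the additive group act
on the affine line by `x ↦ x + P(t)`, transitively if `P ≠ 0`. The power functions are linearly
independent, so there are additive polynomials `P₁, …, P_d` and elements `e₁, …, e_d` of `k` with
`Pᵢ(eⱼ) = δᵢⱼ` (`exists_dual_additive`). Put `P₀ = P₁ + ⋯ + P_d` and let the group act on the
product of `d + 1` lines through `P₀, …, P_d`. All orbit directions lie in the hyperplane `x₀ = x₁ +
⋯ + x_d`.

Let `T` be the translation of the product by `(1, 0, …, 0)`. This vector is off the hyperplane, so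
`T` moves every point to another orbit. Yet on any proper subset of the factors `T` looks like a
group element: `0` if factor `0` is missing, `eⱼ` if factor `j ≥ 1` is missing
(`Ga.exists_withSum`). Hence `T` fixes every invariant in `k(X_I)`, `I` proper
(`Ga.prodShift_fixes`), and such invariants cannot separate orbits
(`GVariety.not_separatesOrbitsInGeneralPosition`). They do not generate the field of invariants
either: `T` fixes whatever they generate, but adds `1` to the invariant `x₀ - x₁ - ⋯ - x_d`. -/

noncomputable section

namespace RationalInvariants

section

/-! ### Pull-back of rational functions -/

section FunctionFields

theorem functionFieldMap_comp {X Y Z : Scheme.{u}} [IrreducibleSpace X] [IrreducibleSpace Y]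
    [IrreducibleSpace Z] (f : X ⟶ Y) (g : Y ⟶ Z) [IsDominant f] [IsDominant g]
    [IsDominant (f ≫ g)] :
    functionFieldMap (f ≫ g) = (functionFieldMap f).comp (functionFieldMap g) := by
  rw [functionFieldMap, functionFieldMap, functionFieldMap, ← CommRingCat.hom_comp]
  congr 1
  rw [Scheme.Hom.stalkMap_comp, Category.assoc, ← Scheme.Hom.stalkSpecializes_stalkMap_assoc,
    TopCat.Presheaf.stalkSpecializes_comp_assoc]
  rfl

theorem functionFieldMap_congr {X Y : Scheme.{u}} [IrreducibleSpace X] [IrreducibleSpace Y]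
    {f g : X ⟶ Y} [IsDominant f] [IsDominant g] (h : f = g) :
    functionFieldMap f = functionFieldMap g := by
  subst h
  rfl

/-- Regular functions are pulled back as rational functions. -/
theorem functionFieldMap_germ_top {X Y : Scheme.{u}} [IrreducibleSpace X] [IrreducibleSpace Y]
    (f : X ⟶ Y) [IsDominant f] (s : Γ(Y, ⊤)) :
    functionFieldMap f (Y.presheaf.germ ⊤ (genericPoint Y) (TopologicalSpace.Opens.mem_top _) s) =
      X.presheaf.germ ⊤ (genericPoint X) (TopologicalSpace.Opens.mem_top _) (f.appTop s) := by
  rw [functionFieldMap, CommRingCat.comp_apply, TopCat.Presheaf.germ_stalkSpecializes_apply]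
  exact Scheme.Hom.germ_stalkMap_apply f ⊤ (genericPoint X) trivial s

theorem algebraMap_stalkMap {X Y : Scheme.{u}} [IrreducibleSpace X] [IrreducibleSpace Y]
    (f : X ⟶ Y) [IsDominant f] (x : X) (s : Y.presheaf.stalk (f x)) :
    algebraMap (X.presheaf.stalk x) X.functionField (f.stalkMap x s) =
      functionFieldMap f (algebraMap (Y.presheaf.stalk (f x)) Y.functionField s) := by
  simp only [RingHom.algebraMap_toAlgebra, functionFieldMap]
  rw [← CommRingCat.comp_apply, ← CommRingCat.comp_apply]
  rw [← Scheme.Hom.stalkSpecializes_stalkMap, TopCat.Presheaf.stalkSpecializes_comp_assoc]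

end FunctionFields

/-! ### Points and values of rational functions -/

variable {k : Type u} [Field k]

theorem Point.eval_stalkMap {X Y : Over (Spec (.of k))} (x : Point X) (f : X ⟶ Y)
    (s : Y.left.presheaf.stalk (f.left x.pt)) :
    x.eval (f.left.stalkMap x.pt s) = Point.eval (X := Y) (x ≫ f) s := by
  exact (ConcreteCategory.congr_hom (Scheme.stalkClosedPointTo_comp (R := .of k) x.left f.left) s).symm

/-- Every nonempty open subset of a variety over an algebraically closed field contains a point. -/
theorem IsVariety.exists_point_mem [IsAlgClosed k] {X : Over (Spec (.of k))} (h : IsVariety X)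
    (U : X.left.Opens) (hU : (U : Set X.left).Nonempty) : ∃ x : Point X, x.pt ∈ U := by
  have := h.isIntegral
  have := h.locallyOfFiniteType
  have := h.quasiCompact
  have : JacobsonSpace X.left := LocallyOfFiniteType.jacobsonSpace (Y := Spec _) X.hom
  obtain ⟨x, hxU, hx⟩ := nonempty_inter_closedPoints (X := X.left) (Z := (U : Set X.left))
    hU U.isOpen.isLocallyClosed
  refine ⟨Over.homMk (pointOfClosedPoint X.hom x hx) (pointOfClosedPoint_comp _ _ _), ?_⟩
  have e : Point.pt (X := X) (Over.homMk (pointOfClosedPoint X.hom x hx)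
      (pointOfClosedPoint_comp _ _ _)) = x := pointOfClosedPoint_apply X.hom x hx _
  rw [e]
  exact hxU

namespace GVariety

variable {G : Over (Spec (.of k))} [GrpObj G]

/-- On an integral scheme the stalks embed in the function field, so the germ representing `f` at
`x` is determined by `f`. -/
theorem HasValueAt.unique {X : GVariety G} {f : X.K} {x : Point X.space} {a b : k}
    (ha : X.HasValueAt f x a) (hb : X.HasValueAt f x b) : a = b := by
  obtain ⟨s, hs, rfl⟩ := ha
  obtain ⟨t, ht, rfl⟩ := hb
  have : Function.Injective (algebraMap (X.space.left.presheaf.stalk x.pt) X.K) :=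
    IsFractionRing.injective _ _
  rw [this (hs.trans ht.symm)]

theorem HasValueAt.pullback {X : GVariety G} {f : X.K} {x : Point X.space} {b : k}
    (T : X.space ⟶ X.space) [IsDominant T.left] (h : X.HasValueAt f (x ≫ T) b) :
    X.HasValueAt (functionFieldMap T.left f) x b := by
  obtain ⟨s, rfl, rfl⟩ := h
  exact ⟨T.left.stalkMap x.pt s, algebraMap_stalkMap T.left x.pt s, x.eval_stalkMap T s⟩

end GVariety

end

/-! ### Translations, invariants and a criterion against separation -/

namespace GVariety

variable {k : Type u} [Field k] {G : Over (Spec (.of k))} [GrpObj G]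

theorem translate_comp_of_equivariant {X Y : GVariety G} (f : X.space ⟶ Y.space)
    (hf : X.act ≫ f = G ◁ f ≫ Y.act) (g : Point G) :
    X.translate g ≫ f = f ≫ Y.translate g := by
  rw [translate, translate, Category.assoc, hf, lift_whiskerLeft_assoc, Category.id_comp,
    comp_lift_assoc, Category.comp_id, ← Category.assoc f, toUnit_unique (f ≫ toUnit _) (toUnit _)]

theorem prod_translate_π {J : Type} [Finite J] (X : J → GVariety G) (g : Point G) (i : J) :
    (prod X).translate g ≫ Pi.π (fun i => (X i).space) i =
      Pi.π (fun i => (X i).space) i ≫ (X i).translate g :=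
  translate_comp_of_equivariant (X := prod X) (Y := X i) _ (prod_act_π X i) g

theorem mem_invariants_iff (X : GVariety G) (f : X.K) :
    f ∈ X.invariants ↔ ∀ g : Point G, functionFieldMap (X.translate g).left f = f := by
  simp [invariants, Subfield.mem_iInf, RingHom.mem_eqLocusField]

/-- An automorphism that moves every point to another orbit but fixes all elements of `S` keeps
`S` from separating orbits in general position. -/
theorem not_separatesOrbitsInGeneralPosition [IsAlgClosed k] (X : GVariety G) (S : Set X.K)
    (T : X.space ⟶ X.space) [IsIso T] [IsDominant T.left]
    (hS : ∀ f ∈ S, functionFieldMap T.left f = f)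
    (hT : ∀ x : Point X.space, ¬ X.SameOrbit x (x ≫ T)) :
    ¬ X.SeparatesOrbitsInGeneralPosition S := by
  rintro ⟨U, hU, h⟩
  have hU' : (U : Set X.space.left).Nonempty := hU.nonempty
  have : IsIso T.left := inferInstanceAs (IsIso ((Over.forget _).map T))
  have hV : ((T.left ⁻¹ᵁ U : X.space.left.Opens) : Set X.space.left).Nonempty :=
    hU'.preimage T.left.surjective
  -- By irreducibility some `x` has both `x` and its image under `T` in `U`.
  obtain ⟨x, hx, hx'⟩ := X.isVariety.exists_point_mem (U ⊓ T.left ⁻¹ᵁ U)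
    (nonempty_preirreducible_inter U.isOpen (T.left ⁻¹ᵁ U).isOpen hU' hV)
  obtain ⟨f, hf, a, b, ha, hb, hab⟩ := h x (x ≫ T) hx hx' (hT x)
  -- The value of `f` at the image of `x` is the value at `x` of the pull-back of `f`, which is `f`
  -- itself.
  have hb' := hb.pullback T
  rw [hS f hf] at hb'
  exact hab (ha.unique hb')

section Product

variable {J : Type} [Finite J] (X : J → GVariety G) (I : Finset J)

theorem proj_π (i : I) :
    proj X I ≫ Pi.π (fun i : I => (X i).space) i = Pi.π (fun j => (X j).space) i :=
  Pi.lift_π _ _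

theorem prod_translate_proj (g : Point G) :
    (prod X).translate g ≫ proj X I = proj X I ≫ (partialProd X I).translate g := by
  apply Pi.hom_ext
  intro i
  have h1 := prod_translate_π X g i
  have h2 := prod_translate_π (fun i : I => X i) g i
  have h3 := proj_π X I i
  refine (Category.assoc _ _ _).trans (Eq.trans ?_ (Category.assoc _ _ _).symm)
  refine (congrArg ((prod X).translate g ≫ ·) h3).trans (Eq.trans ?_
    (congrArg (proj X I ≫ ·) h2).symm)
  exact h1.trans ((congrArg (· ≫ (X i).translate g) h3).symm.trans (Category.assoc _ _ _))

variable [IsAlgClosed k]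

theorem partialInvariants_le_partialField : partialInvariants X I ≤ partialField X I := by
  rintro _ ⟨f, -, rfl⟩
  exact ⟨f, rfl⟩

/-- The projection to the partial product is equivariant, so pull-back along it commutes with
translations. -/
theorem partialInvariants_le_invariants : partialInvariants X I ≤ (prod X).invariants := by
  rintro _ ⟨f, hf, rfl⟩
  rw [mem_invariants_iff]
  intro g
  have hf' := (mem_invariants_iff _ f).1 hf g
  have : IsDominant ((prod X).translate g ≫ proj X I).left := by
    rw [Over.comp_left]; infer_instance
  have e : functionFieldMap (((prod X).translate g).left ≫ (proj X I).left) =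
      functionFieldMap ((proj X I).left ≫ ((partialProd X I).translate g).left) :=
    functionFieldMap_congr (by rw [← Over.comp_left, ← Over.comp_left, prod_translate_proj])
  rw [functionFieldMap_comp, functionFieldMap_comp] at e
  have := DFunLike.congr_fun e f
  rw [RingHom.comp_apply, RingHom.comp_apply, hf'] at this
  exact this

/-- If an endomorphism of the product agrees on the factors in `I` with the translation by a point
of `G`, then it fixes the rational invariants that depend only on the factors in `I`. -/
theorem functionFieldMap_eq_self (T : (prod X).space ⟶ (prod X).space) [IsDominant T.left]
    (g : Point G) (hT : ∀ i ∈ I, T ≫ Pi.π (fun i => (X i).space) i =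
      Pi.π (fun i => (X i).space) i ≫ (X i).translate g)
    {f : (prod X).K} (hf : f ∈ (prod X).invariants) (hfI : f ∈ partialField X I) :
    functionFieldMap T.left f = f := by
  have hT' : T ≫ proj X I = (prod X).translate g ≫ proj X I := by
    apply Pi.hom_ext
    intro i
    refine (Category.assoc _ _ _).trans (Eq.trans ?_ (Category.assoc _ _ _).symm)
    have h3 := proj_π X I i
    have h := (hT i i.2).trans (prod_translate_π X g i).symm
    rw [← h3] at h
    exact h
  obtain ⟨h, rfl⟩ := hfI
  -- A function pulled back from `X_I` sees an endomorphism only through its composite with the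
  -- projection; there `T` and the translation by `g` agree.
  have e : functionFieldMap (T.left ≫ (proj X I).left) =
      functionFieldMap (((prod X).translate g).left ≫ (proj X I).left) :=
    functionFieldMap_congr (by rw [← Over.comp_left, ← Over.comp_left, hT'])
  rw [functionFieldMap_comp, functionFieldMap_comp] at e
  have e' := DFunLike.congr_fun e h
  rw [RingHom.comp_apply, RingHom.comp_apply] at e'
  exact e'.trans ((mem_invariants_iff _ _).1 hf g)

end Product

end GVariety

/-! ### Additive polynomials -/

section Arithmetic

variable {k : Type u} [Field k] (p : ℕ)

/-- The value at `s` of the additive polynomial `∑ aᵢ t ^ (p ^ i)`, in a ring under `k`. -/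
def additiveEval {d : ℕ} (a : Fin d → k) {R : Type u} [CommRing R] (ι : k →+* R) (s : R) : R :=
  ∑ i, ι (a i) * s ^ p ^ (i : ℕ)

theorem map_additiveEval {d : ℕ} (a : Fin d → k) {R R' : Type u} [CommRing R] [CommRing R']
    (ι : k →+* R) (φ : R →+* R') (s : R) :
    φ (additiveEval p a ι s) = additiveEval p a (φ.comp ι) (φ s) := by
  simp [additiveEval]

theorem additiveEval_add [Fact p.Prime] [CharP k p] {d : ℕ} (a : Fin d → k) {R : Type u}
    [CommRing R] (ι : k →+* R) (s t : R) :
    additiveEval p a ι (s + t) = additiveEval p a ι s + additiveEval p a ι t := by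
  -- `R` may be the zero ring, so only `p = 0` in `R` is available, not `CharP R p`; it suffices for
  -- the Frobenius identity.
  have hp : (p : R) = 0 := by rw [← map_natCast ι, CharP.cast_eq_zero, map_zero]
  have h (n : ℕ) : (s + t) ^ p ^ n = s ^ p ^ n + t ^ p ^ n := by
    obtain ⟨r, hr⟩ := exists_add_pow_prime_pow_eq (R := R) (Fact.out : p.Prime) s t n
    rw [hr, hp]
    ring
  simp [additiveEval, h, mul_add, Finset.sum_add_distrib]

theorem additiveEval_zero [Fact p.Prime] {d : ℕ} (a : Fin d → k) {R : Type u}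
    [CommRing R] (ι : k →+* R) : additiveEval p a ι 0 = 0 := by
  have hp : p ≠ 0 := (Fact.out : p.Prime).ne_zero
  simp [additiveEval, hp]

theorem additiveEval_sum {d n : ℕ} (a : Fin n → Fin d → k) {R : Type u}
    [CommRing R] (ι : k →+* R) (s : R) :
    additiveEval p (∑ j, a j) ι s = ∑ j, additiveEval p (a j) ι s := by
  simp only [additiveEval, Finset.sum_apply, map_sum, Finset.sum_mul]
  exact Finset.sum_comm

/-- A nonzero additive polynomial over an algebraically closed field is surjective. -/
theorem additiveEval_surjective [Fact p.Prime] [IsAlgClosed k] {d : ℕ} (a : Fin d → k)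
    {e : k} (he : additiveEval p a (RingHom.id k) e ≠ 0) :
    Function.Surjective (additiveEval p a (RingHom.id k)) := by
  intro c
  let P : Polynomial k := ∑ i, Polynomial.C (a i) * Polynomial.X ^ p ^ (i : ℕ)
  have hP (t : k) : P.eval t = additiveEval p a (RingHom.id k) t := by
    simp [P, additiveEval, Polynomial.eval_finsetSum]
  -- A constant `P - c` would take equal values at `0` and `e`, but `P(0) = 0 ≠ P(e)`.
  obtain ⟨t, ht⟩ := IsAlgClosed.exists_root (P - Polynomial.C c) (by
    intro h
    have h' := Polynomial.eq_C_of_degree_eq_zero h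
    have h0 := hP 0
    have h1 := hP e
    have e0 := congrArg (Polynomial.eval 0) h'
    have e1 := congrArg (Polynomial.eval e) h'
    rw [additiveEval_zero] at h0
    rw [Polynomial.eval_sub, Polynomial.eval_C, Polynomial.eval_C] at e0 e1
    apply he
    rw [← h1]
    linear_combination e1 - e0 + h0)
  refine ⟨t, ?_⟩
  rw [Polynomial.IsRoot, Polynomial.eval_sub, Polynomial.eval_C, hP] at ht
  exact sub_eq_zero.1 ht

/-- Additive polynomials can be interpolated: there are `d` of them, and `d` elements of an
infinite field, that are dual to each other. -/
theorem exists_dual_additive [Fact p.Prime] [Infinite k] (d : ℕ) :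
    ∃ (a : Fin d → Fin d → k) (e : Fin d → k),
      ∀ i j, additiveEval p (a i) (RingHom.id k) (e j) = if i = j then 1 else 0 := by
  -- Dedekind's independence of characters; the power maps are distinct because `k` is infinite.
  have hli : LinearIndependent k (fun (i : Fin d) (t : k) => t ^ p ^ (i : ℕ)) := by
    have h := (linearIndependent_monoidHom k k).comp
      (fun i : Fin d => powMonoidHom (p ^ (i : ℕ))) (by
        intro i j hij
        by_contra hne
        have hne' : p ^ (i : ℕ) ≠ p ^ (j : ℕ) := fun h =>
          hne (Fin.ext (Nat.pow_right_injective (Fact.out : p.Prime).two_le h))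
        have hX : (Polynomial.X ^ p ^ (i : ℕ) : Polynomial k) = Polynomial.X ^ p ^ (j : ℕ) := by
          apply Polynomial.funext
          intro t
          simpa using DFunLike.congr_fun hij t
        exact hne' (by simpa using congrArg Polynomial.natDegree hX))
    exact h
  let v : k → Fin d → k := fun t i => t ^ p ^ (i : ℕ)
  -- A nonzero functional vanishing on all `v t` would be a linear relation between the power
  -- functions.
  have hspan : Submodule.span k (Set.range v) = ⊤ := by
    by_contra hne
    obtain ⟨φ, hφ, hφ'⟩ := Submodule.exists_le_ker_of_lt_top _ (lt_top_iff_ne_top.2 hne)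
    apply hφ
    have hz : ∀ i, φ (Pi.single i 1) = 0 := by
      apply Fintype.linearIndependent_iff.1 hli
      funext t
      have ht : φ (v t) = 0 := hφ' (Submodule.subset_span ⟨t, rfl⟩)
      rw [← Finset.univ_sum_single (v t), map_sum] at ht
      rw [Finset.sum_apply, Pi.zero_apply, ← ht]
      refine Finset.sum_congr rfl fun i _ => ?_
      have : Pi.single i (v t i) = v t i • (Pi.single i 1 : Fin d → k) := by
        rw [← Pi.single_smul, smul_eq_mul, mul_one]
      rw [this, map_smul]
      simp [v, mul_comm]
    apply LinearMap.pi_ext'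
    intro i
    apply LinearMap.ext_ring
    simpa using hz i
  -- Some of the vectors `v t` form a basis; their parameters are the `e j`, and the dual basis
  -- supplies the coefficients `a i`.
  obtain ⟨s, hs, hs'⟩ := exists_linearIndependent k (Set.range v)
  rw [hspan] at hs'
  let b : Module.Basis s k (Fin d → k) := Module.Basis.mk hs'.2 (by
    rw [Subtype.range_coe, hs'.1])
  have : Fintype s := FiniteDimensional.fintypeBasisIndex b
  let σ : s ≃ Fin d := Fintype.equivOfCardEq (by
    rw [← Module.finrank_eq_card_basis b, Module.finrank_fin_fun, Fintype.card_fin])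
  let b' := b.reindex σ
  have hb' (j : Fin d) : ∃ t, v t = b' j := by
    obtain ⟨t, ht⟩ := hs (σ.symm j).2
    exact ⟨t, by simp [b', b, ht]⟩
  choose e he using hb'
  refine ⟨fun i m => b'.coord i (Pi.single m 1), e, fun i j => ?_⟩
  have h : b'.coord i (v (e j)) = if i = j then 1 else 0 := by
    rw [he]
    simp [Finsupp.single_apply, eq_comm]
  rw [← h, ← Finset.univ_sum_single (v (e j)), map_sum]
  refine Finset.sum_congr rfl fun m _ => ?_
  have : Pi.single m (v (e j) m) = v (e j) m • (Pi.single m 1 : Fin d → k) := by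
    rw [← Pi.single_smul, smul_eq_mul, mul_one]
  rw [this, map_smul]
  simp [v, mul_comm]

end Arithmetic

/-! ### The affine line with translations through an additive polynomial -/

section

variable {k : Type u} [Field k]

/-- The constant functions on `T`. -/
def scalar (T : Over (Spec (.of k))) : k →+* Γ(T.left, ⊤) :=
  T.hom.appTop.hom.comp (Scheme.ΓSpecIso (.of k)).inv.hom

theorem appTop_scalar {T T' : Over (Spec (.of k))} (h : T ⟶ T') (a : k) :
    h.left.appTop (scalar T' a) = scalar T a := by
  rw [scalar, scalar, ← Over.w h]
  rfl

theorem appTop_comp_scalar {T T' : Over (Spec (.of k))} (h : T ⟶ T') :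
    h.left.appTop.hom.comp (scalar T') = scalar T :=
  RingHom.ext (appTop_scalar h)

/-- Identifies the points of the affine line with `k`: surjectivity gives `Ga.exists_eq_point`,
injectivity gives `Ga.shift_injective`. -/
theorem scalar_unit_bijective :
    Function.Bijective (scalar (𝟙_ (Over (Spec (.of k))))) := by
  have h : (scalar (𝟙_ (Over (Spec (.of k))))) = (Scheme.ΓSpecIso (.of k)).inv.hom := by
    ext a
    change (Scheme.Hom.appTop (𝟙 (Spec (.of k)))) _ = _
    simp
  rw [h]
  exact (ConcreteCategory.bijective_of_isIso (Scheme.ΓSpecIso (.of k)).inv)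

namespace Ga

theorem isVariety : IsVariety (Ga k) where
  geometricallyIntegral := inferInstanceAs (GeometricallyIntegral (𝔸(PUnit.{u + 1}; Spec (.of k)) ↘ _))
  isSeparated := inferInstanceAs (IsSeparated (𝔸(PUnit.{u + 1}; Spec (.of k)) ↘ _))
  locallyOfFiniteType := inferInstanceAs (LocallyOfFiniteType (𝔸(PUnit.{u + 1}; Spec (.of k)) ↘ _))
  quasiCompact := inferInstanceAs (QuasiCompact (𝔸(PUnit.{u + 1}; Spec (.of k)) ↘ _))

/-- The `k`-rational point of `Ga` with coordinate `t`. -/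
def point (t : k) : Point (Ga k) := ofSection (scalar _ t)

theorem exists_eq_point (x : Point (Ga k)) : ∃ t, x = point t := by
  obtain ⟨t, ht⟩ := scalar_unit_bijective.2 (coord x)
  exact ⟨t, hom_ext (by rw [point, coord_ofSection, ht])⟩

theorem comp_point {T : Over (Spec (.of k))} (f : T ⟶ 𝟙_ (Over (Spec (.of k)))) (t : k) :
    coord (f ≫ point t) = scalar T t := by
  rw [coord_comp, point, coord_ofSection, appTop_scalar]

/-- The morphism adding the constant `c` to the coordinate. -/
def shift (c : k) : Ga k ⟶ Ga k := ofSection (coord (𝟙 (Ga k)) + scalar _ c)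

theorem coord_comp_shift {T : Over (Spec (.of k))} (f : T ⟶ Ga k) (c : k) :
    coord (f ≫ shift c) = coord f + scalar T c := by
  rw [coord_comp, shift, coord_ofSection, map_add, ← coord_comp, Category.comp_id, appTop_scalar]

variable (p : ℕ)

/-- The morphism `(t, x) ↦ P(t) + x` for the additive polynomial `P` with coefficients `a`. -/
def additiveAct {d : ℕ} (a : Fin d → k) : Ga k ⊗ Ga k ⟶ Ga k :=
  ofSection (additiveEval p a (scalar _) (coord (fst (Ga k) (Ga k))) + coord (snd (Ga k) (Ga k)))

theorem coord_comp_additiveAct {d : ℕ} (a : Fin d → k) {T : Over (Spec (.of k))}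
    (f : T ⟶ Ga k ⊗ Ga k) :
    coord (f ≫ additiveAct p a) =
      additiveEval p a (scalar T) (coord (f ≫ fst _ _)) + coord (f ≫ snd _ _) := by
  rw [coord_comp, additiveAct, coord_ofSection, map_add, ← coord_comp, coord_comp f (fst _ _),
    ← appTop_comp_scalar f]
  exact congrArg (· + _) (map_additiveEval p a _ f.left.appTop.hom _)

variable [Fact p.Prime] [CharP k p]

/-- The affine line, on which `Ga` acts by translations through the additive polynomial with
coefficients `a`. -/
abbrev additiveVariety {d : ℕ} (a : Fin d → k) : GVariety (Ga k) where
  space := Ga k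
  isVariety := isVariety
  modObj :=
    { smul := additiveAct p a
      one_smul := by
        change ofSection 0 ▷ Ga k ≫ additiveAct p a = (λ_ (Ga k)).hom
        apply hom_ext
        rw [coord_comp_additiveAct, whiskerRight_fst, whiskerRight_snd, comp_ofSection,
          coord_ofSection, map_zero, additiveEval_zero, zero_add, leftUnitor_hom]
      mul_smul := by
        change add k ▷ Ga k ≫ additiveAct p a =
          (α_ (Ga k) (Ga k) (Ga k)).hom ≫ Ga k ◁ additiveAct p a ≫ additiveAct p a
        apply hom_ext
        rw [coord_comp_additiveAct, whiskerRight_fst, whiskerRight_snd, coord_comp_add,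
          ← Category.assoc, coord_comp_additiveAct, Category.assoc, Category.assoc,
          whiskerLeft_fst, whiskerLeft_snd, associator_hom_fst, ← Category.assoc,
          coord_comp_additiveAct, Category.assoc, Category.assoc, associator_hom_snd_fst,
          associator_hom_snd_snd, additiveEval_add, add_assoc] }

theorem coord_comp_translate {d : ℕ} (a : Fin d → k) {T : Over (Spec (.of k))} (f : T ⟶ Ga k)
    (t : k) :
    coord (f ≫ (additiveVariety p a).translate (point t)) =
      scalar T (additiveEval p a (RingHom.id k) t) + coord f := by
  change coord (f ≫ lift (toUnit (Ga k) ≫ point t) (𝟙 (Ga k)) ≫ additiveAct p a) = _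
  rw [← Category.assoc, coord_comp_additiveAct, Category.assoc, Category.assoc, lift_fst, lift_snd,
    Category.comp_id, ← Category.assoc, comp_point, map_additiveEval, RingHom.comp_id]

theorem comp_translate_eq_shift {d : ℕ} (a : Fin d → k) {T : Over (Spec (.of k))} (f : T ⟶ Ga k)
    (t : k) :
    f ≫ (additiveVariety p a).translate (point t) =
      f ≫ shift (additiveEval p a (RingHom.id k) t) := by
  apply hom_ext
  rw [coord_comp_translate, coord_comp_shift, add_comm]

theorem shift_injective (f : Point (Ga k)) {b c : k}
    (h : f ≫ shift b = f ≫ shift c) : b = c := by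
  have := congrArg coord h
  rw [coord_comp_shift, coord_comp_shift] at this
  exact scalar_unit_bijective.1 (add_left_cancel this)

theorem additiveVariety_isHomogeneous [IsAlgClosed k] {d : ℕ} (a : Fin d → k)
    {e : k} (he : additiveEval p a (RingHom.id k) e ≠ 0) :
    (additiveVariety p a).IsHomogeneous := by
  intro x y
  obtain ⟨s, rfl⟩ := exists_eq_point x
  obtain ⟨t, rfl⟩ := exists_eq_point y
  obtain ⟨c, hc⟩ := additiveEval_surjective p a he (t - s)
  refine ⟨point c, ?_⟩
  rw [← GVariety.comp_translate]
  apply hom_ext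
  rw [coord_comp_translate, hc]
  simp [point, coord_ofSection]

end Ga

end

/-! ### Which vectors are values of the tuple of additive polynomials -/

namespace Ga

section Interpolation

variable {k : Type u} [Field k] {d : ℕ}

/-- The given additive polynomials together with their sum. -/
abbrev withSum (a : Fin d → Fin d → k) : Fin (d + 1) → Fin d → k := Fin.cons (∑ j, a j) a

variable (p : ℕ) {a : Fin d → Fin d → k} {e : Fin d → k}

/-- The zeroth polynomial is the sum of the others, so where these vanish it cannot be `1`. -/
theorem not_exists_withSum :
    ¬ ∃ t, ∀ i, additiveEval p (withSum a i) (RingHom.id k) t =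
      (Pi.single 0 1 : Fin (d + 1) → k) i := by
  rintro ⟨t, ht⟩
  have h0 := ht 0
  have hs : ∀ j : Fin d, additiveEval p (a j) (RingHom.id k) t = 0 := fun j => by
    simpa using ht j.succ
  simp [additiveEval_sum, hs] at h0

variable [Fact p.Prime]

theorem exists_withSum
    (h : ∀ i j, additiveEval p (a i) (RingHom.id k) (e j) = if i = j then 1 else 0)
    {I : Finset (Fin (d + 1))} (hI : I ≠ Finset.univ) :
    ∃ t, ∀ i ∈ I, additiveEval p (withSum a i) (RingHom.id k) t =
      (Pi.single 0 1 : Fin (d + 1) → k) i := by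
  obtain ⟨j, hj⟩ : ∃ j, j ∉ I := by
    by_contra! H
    exact hI (Finset.eq_univ_of_forall H)
  induction j using Fin.cases with
  | zero =>
    -- Without index `0` all prescribed values are zero.
    refine ⟨0, fun i hi => ?_⟩
    rw [additiveEval_zero, Pi.single_eq_of_ne]
    rintro rfl
    exact hj hi
  | succ j =>
    -- At `e j` the sum takes the value `1`, and the only other polynomial that does not vanish is
    -- the one with the omitted index.
    refine ⟨e j, fun i hi => ?_⟩
    induction i using Fin.cases with
    | zero => simp [additiveEval_sum, h]
    | succ i =>
      have : i ≠ j := by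
        rintro rfl
        exact hj hi
      simp [h, this]

end Interpolation

variable {k : Type u} [Field k] (p : ℕ) [Fact p.Prime] [CharP k p]

/-- The affine spaces on which `Ga` acts by translations, through the tuple of additive polynomials
with coefficients `a i`: the factors. -/
abbrev additiveFamily {J : Type} {d : ℕ} (a : J → Fin d → k) : J → GVariety (Ga k) :=
  fun i => additiveVariety p (a i)

/-! ### Products of affine lines and their translations by vectors -/

section Family

variable {J : Type} [Finite J] {d : ℕ} (a : J → Fin d → k)

/-- The projection from the product to a factor, which is the affine line. -/
def prodCoord (i : J) : (GVariety.prod (additiveFamily p a)).space ⟶ Ga k :=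
  Pi.π (fun i => (additiveFamily p a i).space) i

/-- Translation of the product by the vector `c`. -/
def prodShift (c : J → k) : (GVariety.prod (additiveFamily p a)).space ⟶
    (GVariety.prod (additiveFamily p a)).space :=
  Pi.lift fun i => prodCoord p a i ≫ shift (c i)

theorem prodCoord_hom_ext {T : Over (Spec (.of k))}
    {f g : T ⟶ (GVariety.prod (additiveFamily p a)).space}
    (h : ∀ i, coord (f ≫ prodCoord p a i) = coord (g ≫ prodCoord p a i)) : f = g :=
  Pi.hom_ext _ _ fun i => hom_ext (h i)

theorem prodShift_prodCoord (c : J → k) (i : J) :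
    prodShift p a c ≫ prodCoord p a i = prodCoord p a i ≫ shift (c i) :=
  Pi.lift_π _ _

theorem translate_prodCoord (t : k) (i : J) :
    (GVariety.prod (additiveFamily p a)).translate (point t) ≫ prodCoord p a i =
      prodCoord p a i ≫ shift (additiveEval p (a i) (RingHom.id k) t) :=
  (GVariety.prod_translate_π (additiveFamily p a) (point t) i).trans
    (comp_translate_eq_shift p (a i) (prodCoord p a i) t)

theorem prodShift_comp (b c : J → k) :
    prodShift p a b ≫ prodShift p a c = prodShift p a (b + c) := by
  apply prodCoord_hom_ext
  intro i
  rw [Category.assoc, prodShift_prodCoord, ← Category.assoc, prodShift_prodCoord,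
    prodShift_prodCoord, coord_comp_shift, coord_comp_shift, coord_comp_shift, Pi.add_apply,
    map_add, add_assoc]

theorem prodShift_zero : prodShift p a 0 = 𝟙 _ := by
  apply prodCoord_hom_ext
  intro i
  rw [prodShift_prodCoord, coord_comp_shift, Pi.zero_apply, map_zero, add_zero, Category.id_comp]

instance (c : J → k) : IsIso (prodShift p a c) :=
  ⟨prodShift p a (-c), by rw [prodShift_comp, add_neg_cancel, prodShift_zero],
    by rw [prodShift_comp, neg_add_cancel, prodShift_zero]⟩

instance (c : J → k) : IsDominant (prodShift p a c).left := by
  have : IsIso (prodShift p a c).left :=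
    inferInstanceAs (IsIso ((Over.forget _).map (prodShift p a c)))
  infer_instance

/-- The orbit of `x` consists of the translates of `x` by the values of the tuple of polynomials,
and different vectors move `x` to different points. -/
theorem not_sameOrbit_prodShift (c : J → k)
    (hc : ¬ ∃ t, ∀ i, additiveEval p (a i) (RingHom.id k) t = c i)
    (x : Point (GVariety.prod (additiveFamily p a)).space) :
    ¬ (GVariety.prod (additiveFamily p a)).SameOrbit x (x ≫ prodShift p a c) := by
  rintro ⟨g, hg⟩
  obtain ⟨t, rfl⟩ := exists_eq_point g
  refine hc ⟨t, fun i => shift_injective (x ≫ prodCoord p a i) ?_⟩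
  rw [← GVariety.comp_translate] at hg
  have := congrArg (· ≫ prodCoord p a i) hg
  simpa only [Category.assoc, translate_prodCoord, prodShift_prodCoord] using this

theorem prodShift_fixes [IsAlgClosed k] (c : J → k) (I : Finset J)
    (hc : ∃ t, ∀ i ∈ I, additiveEval p (a i) (RingHom.id k) t = c i)
    {f : (GVariety.prod (additiveFamily p a)).K}
    (hf : f ∈ (GVariety.prod (additiveFamily p a)).invariants)
    (hfI : f ∈ GVariety.partialField (additiveFamily p a) I) :
    functionFieldMap (prodShift p a c).left f = f := by
  obtain ⟨t, ht⟩ := hc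
  refine GVariety.functionFieldMap_eq_self (additiveFamily p a) I _ (point t) (fun i hi => ?_)
    hf hfI
  refine (prodShift_prodCoord p a c i).trans ?_
  rw [← ht i hi]
  exact (comp_translate_eq_shift p (a i) (prodCoord p a i) t).symm

/-- The coordinate functions of the product, as rational functions. -/
def coordFunction (i : J) : (GVariety.prod (additiveFamily p a)).K :=
  (GVariety.prod (additiveFamily p a)).space.left.presheaf.germ ⊤ (genericPoint _)
    (TopologicalSpace.Opens.mem_top _) (coord (prodCoord p a i))

/-- The constants, as rational functions on the product. -/
def constFunction : k →+* (GVariety.prod (additiveFamily p a)).K :=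
  ((GVariety.prod (additiveFamily p a)).space.left.presheaf.germ ⊤ (genericPoint _)
    (TopologicalSpace.Opens.mem_top _)).hom.comp (scalar _)

theorem functionFieldMap_coordFunction (T : (GVariety.prod (additiveFamily p a)).space ⟶
    (GVariety.prod (additiveFamily p a)).space) [IsDominant T.left] (i : J) (c : k)
    (hT : T ≫ prodCoord p a i = prodCoord p a i ≫ shift c) :
    functionFieldMap T.left (coordFunction p a i) =
      coordFunction p a i + constFunction p a c := by
  rw [coordFunction, functionFieldMap_germ_top, ← coord_comp, hT, coord_comp_shift, map_add]
  rfl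

end Family

/-! ### The sum construction: lower bounds and the linear invariant -/

section Hyperplanes

variable {d : ℕ} (a : Fin d → Fin d → k)

/-- The invariant linear form. -/
def linearInvariant : (GVariety.prod (additiveFamily p (withSum a))).K :=
  coordFunction p (withSum a) 0 - ∑ j : Fin d, coordFunction p (withSum a) j.succ

/-- Serves both for translations by group elements, where the added constant is `0`, and for the
shift by `Pi.single 0 1`, where it is `1`. -/
theorem functionFieldMap_linearInvariant (T : (GVariety.prod (additiveFamily p (withSum a))).space ⟶
    (GVariety.prod (additiveFamily p (withSum a))).space) [IsDominant T.left] (c : Fin (d + 1) → k)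
    (hT : ∀ i, T ≫ prodCoord p (withSum a) i = prodCoord p (withSum a) i ≫ shift (c i)) :
    functionFieldMap T.left (linearInvariant p a) =
      linearInvariant p a + constFunction p (withSum a) (c 0 - ∑ j : Fin d, c j.succ) := by
  have h := fun i => functionFieldMap_coordFunction p (withSum a) T i (c i) (hT i)
  simp only [linearInvariant, map_sub, map_sum, h, Finset.sum_add_distrib]
  ring

theorem linearInvariant_mem_invariants :
    linearInvariant p a ∈ (GVariety.prod (additiveFamily p (withSum a))).invariants := by
  rw [GVariety.mem_invariants_iff]
  intro g
  obtain ⟨t, rfl⟩ := exists_eq_point g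
  rw [functionFieldMap_linearInvariant p a _ _ (translate_prodCoord p (withSum a) t)]
  simp [additiveEval_sum]

variable {a} {e : Fin d → k}

theorem withSum_homogeneous [IsAlgClosed k]
    (h : ∀ i j, additiveEval p (a i) (RingHom.id k) (e j) = if i = j then 1 else 0)
    (hd : 1 ≤ d) (i : Fin (d + 1)) :
    (additiveFamily p (withSum a) i).IsHomogeneous := by
  induction i using Fin.cases with
  | zero =>
    -- The sum is `1` at each `e j`; for `d = 0` it would be the empty sum, with trivial action.
    refine additiveVariety_isHomogeneous p _ (e := e ⟨0, hd⟩) ?_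
    simp [additiveEval_sum, h]
  | succ i =>
    refine additiveVariety_isHomogeneous p _ (e := e i) ?_
    simp [h]

theorem exists_mem_notMem_partialField [IsAlgClosed k]
    (h : ∀ i j, additiveEval p (a i) (RingHom.id k) (e j) = if i = j then 1 else 0)
    {S : Set (GVariety.prod (additiveFamily p (withSum a))).K}
    (hS : S ⊆ (GVariety.prod (additiveFamily p (withSum a))).invariants)
    (hsep : (GVariety.prod (additiveFamily p (withSum a))).SeparatesOrbitsInGeneralPosition S) :
    ∃ f ∈ S, ∀ I : Finset (Fin (d + 1)), I ≠ Finset.univ →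
      f ∉ GVariety.partialField (additiveFamily p (withSum a)) I := by
  by_contra! H
  refine GVariety.not_separatesOrbitsInGeneralPosition _ S (prodShift p (withSum a) (Pi.single 0 1))
    (fun f hf => ?_) (not_sameOrbit_prodShift p _ _ (not_exists_withSum p)) hsep
  obtain ⟨I, hI, hfI⟩ := H f hf
  exact prodShift_fixes p _ _ I (exists_withSum p h hI) (hS hf) hfI

theorem le_rhoProd [IsAlgClosed k]
    (h : ∀ i j, additiveEval p (a i) (RingHom.id k) (e j) = if i = j then 1 else 0) :
    ((d + 1 : ℕ) : ℕ∞) ≤ GVariety.rhoProd (additiveFamily p (withSum a)) := by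
  refine le_sInf ?_
  rintro _ ⟨r, rfl, hr⟩
  by_contra! hlt
  have hlt' : r < d + 1 := by exact_mod_cast hlt
  obtain ⟨f, hf, hf'⟩ := exists_mem_notMem_partialField p h (by
    simp only [Set.iUnion_subset_iff]
    intro I _
    exact GVariety.partialInvariants_le_invariants _ I) hr
  simp only [Set.mem_iUnion] at hf
  obtain ⟨I, hI, hfI⟩ := hf
  refine hf' I ?_ (GVariety.partialInvariants_le_partialField _ I hfI)
  rintro rfl
  rw [Finset.card_univ, Fintype.card_fin] at hI
  omega

theorem invariants_ne_iSup [IsAlgClosed k]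
    (h : ∀ i j, additiveEval p (a i) (RingHom.id k) (e j) = if i = j then 1 else 0)
    {r : ℕ} (hr : r ≤ d) :
    (GVariety.prod (additiveFamily p (withSum a))).invariants ≠
      ⨆ (I : Finset (Fin (d + 1))) (_ : I.card ≤ r),
        GVariety.partialInvariants (additiveFamily p (withSum a)) I := by
  intro H
  -- The fixed field of this shift contains all `k(X_I)^G` with `I` proper, hence the field they
  -- generate.
  let T := prodShift p (withSum a) (Pi.single 0 1)
  have hle : (GVariety.prod (additiveFamily p (withSum a))).invariants ≤
      (functionFieldMap T.left).eqLocusField (RingHom.id _) := by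
    rw [H]
    refine iSup₂_le fun I hI f hf => ?_
    refine prodShift_fixes p _ _ I (exists_withSum p h ?_)
      (GVariety.partialInvariants_le_invariants _ I hf)
      (GVariety.partialInvariants_le_partialField _ I hf)
    rintro rfl
    rw [Finset.card_univ, Fintype.card_fin] at hI
    omega
  have h1 : functionFieldMap T.left (linearInvariant p a) = linearInvariant p a :=
    hle (linearInvariant_mem_invariants p a)
  rw [functionFieldMap_linearInvariant p a T _ (prodShift_prodCoord p (withSum a) _)] at h1
  simp at h1

end Hyperplanes

end Ga

end RationalInvariants

end

/-! ### The theorem -/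

open RationalInvariants
theorem proposition4p3 {k : Type u} [Field k] [IsAlgClosed k] (p : ℕ) [Fact p.Prime] [CharP k p] :
    rho (Ga k) = ⊤ ∧
    (∀ d : ℕ, 1 ≤ d → ∃ X : Fin (d + 1) → GVariety (Ga k),
      (∀ i, (X i).IsHomogeneous) ∧
      ∀ S : Set (GVariety.prod X).K, S ⊆ (GVariety.prod X).invariants →
        (GVariety.prod X).SeparatesOrbitsInGeneralPosition S →
        ∃ f ∈ S, ∀ I : Finset (Fin (d + 1)), I ≠ Finset.univ → f ∉ GVariety.partialField X I) ∧
    (∀ r : ℕ, ∃ (m : ℕ) (X : Fin m → GVariety (Ga k)),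
      (GVariety.prod X).invariants ≠
        ⨆ (I : Finset (Fin m)) (_ : I.card ≤ r), GVariety.partialInvariants X I) := by
  have : Infinite k := IsAlgClosed.instInfinite
  refine ⟨?_, fun d hd => ?_, fun r => ?_⟩
  · refine ENat.eq_top_iff_forall_ge.2 fun d => ?_
    obtain ⟨a, e, h⟩ := exists_dual_additive (k := k) p d
    refine le_trans ?_ ((Ga.le_rhoProd p h).trans
      (le_iSup₂ (f := fun (m : ℕ) (X : Fin m → GVariety (Ga k)) => GVariety.rhoProd X) (d + 1) _))
    exact_mod_cast Nat.le_succ d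
  · obtain ⟨a, e, h⟩ := exists_dual_additive (k := k) p d
    exact ⟨_, Ga.withSum_homogeneous p h hd, fun S hS hsep =>
      Ga.exists_mem_notMem_partialField p h hS hsep⟩
  · obtain ⟨a, e, h⟩ := exists_dual_additive (k := k) p r
    -- With `r + 1` factors, every index set of size at most `r` is proper.
    exact ⟨r + 1, _, Ga.invariants_ne_iSup p h le_rfl⟩
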